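/- Write $\mathbb T^1=\mathbb R/\mathbb Z$, $\mathbb I=[0,1]$ and $\mathbb A=\mathbb T^1\times\mathbb I$; the interior $\operatorname{int}\mathbb A=\mathbb T^1\times(0,1)$ is taken in $\mathbb T^1\times\mathbb R$. A quasiperiodically forced increasing interval map is a continuous map $f:\mathbb A\to\mathbb A$ of the form $f(\theta,x)=(\theta+\omega,f_\theta(x))$ with $\omega$ irrational and all fibre maps $f_\theta:\mathbb I\to\mathbb I$ strictly increasing. A continuous invariant curve of $f$ is a set $\Gamma=\{(\theta,\gamma(\theta)) : \theta\in\mathbb T^1\}$ with $\gamma:\mathbb T^1\to\mathbb I$ continuous and $f(\Gamma)=\Gamma$. A set $A\subseteq\mathbb A$ is pinched if for some $\theta\in\mathbb T^1$ the fibre $A_\theta=\{x\in\mathbb I : (\theta,x)\in A\}$ has exactly one element. A minimal set of $f$ is a nonempty closed set $M$ with $f(M)\subseteq M$ that has no proper nonempty closed subset $K$ with $f(K)\subseteq K$. It is almost automorphic if $f$ restricts to a homeomorphism $g$ of $M$ and there is a point $x\in M$ such that, for every sequence $(n_k)$ of integers and every $\tilde x\in M$, $\lim_k g^{n_k}(x)=\tilde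 x$ implies $\lim_k g^{-n_k}(\tilde x)=x$. **Corollary.** There exists a quasiperiodically forced increasing interval map $\hat f:\mathbb A\to\mathbb A$ with the following properties: 1. $\hat f$ has no continuous invariant curves; 2. $\hat f(\mathbb A)\subseteq\operatorname{int}\mathbb A$; 3. the global attractor $\bigcap_{n\in\mathbb N}\hat f^n(\mathbb A)$ is pinched; it contains exactly one minimal set $M$ of $\hat f$, and $M$ is almost automorphic. -/

import Mathlib

open Filter Topology

namespace QPF

/-- The annulus `𝔸 = 𝕋¹ × 𝕀`, with `𝕋¹ = ℝ / ℤ` and `𝕀 = [0, 1]`. -/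
abbrev Annulus : Type := UnitAddCircle × Set.Icc (0 : ℝ) 1

/-- The interior of the annulus, where `𝕋¹ × [0, 1]` is regarded as a subset of `𝕋¹ × ℝ`
(so this is `𝕋¹ × (0, 1)`). -/
def annulusInterior : Set Annulus :=
  {p | (p.1, (p.2 : ℝ)) ∈ interior ((Set.univ : Set UnitAddCircle) ×ˢ Set.Icc (0 : ℝ) 1)}

/-- Quasiperiodically forced increasing interval maps: continuous skew products
`f (θ, x) = (θ + ω, f_θ x)` on the annulus, over an irrational rotation of the circle, all of whose
fibre maps `f_θ` are strictly increasing. -/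
def IsQPFIncreasing (f : Annulus → Annulus) : Prop :=
  Continuous f ∧
    (∃ ω : ℝ, Irrational ω ∧ ∀ p : Annulus, (f p).1 = p.1 + (ω : UnitAddCircle)) ∧
    ∀ θ : UnitAddCircle, StrictMono fun x : Set.Icc (0 : ℝ) 1 => (f (θ, x)).2

/-- `Γ` is a continuous `f`-invariant curve: an invariant set which is the graph of a continuous
function `γ : 𝕋¹ → 𝕀`. -/
def IsInvariantCurve (f : Annulus → Annulus) (Γ : Set Annulus) : Prop :=
  f '' Γ = Γ ∧ ∃ γ : UnitAddCircle → Set.Icc (0 : ℝ) 1,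
    Continuous γ ∧ Γ = {p | ∃ θ, p = (θ, γ θ)}

/-- The global attractor `⋂ₙ fⁿ(𝔸)`. -/
def globalAttractor (f : Annulus → Annulus) : Set Annulus :=
  ⋂ n : ℕ, f^[n] '' Set.univ

/-- A set is pinched if one of its fibres `A_θ` consists of exactly one point. -/
def IsPinched (A : Set Annulus) : Prop :=
  ∃ θ : UnitAddCircle, {x : Set.Icc (0 : ℝ) 1 | (θ, x) ∈ A}.encard = 1

/-- Minimal sets of a map `f`: nonempty closed sets `M` with `f(M) ⊆ M` which have no proper
subset of the same kind. -/
def IsMinimalSet {X : Type*} [TopologicalSpace X] (f : X → X) (M : Set X) : Prop :=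
  M.Nonempty ∧ IsClosed M ∧ Set.MapsTo f M M ∧
    ∀ K ⊆ M, K.Nonempty → IsClosed K → Set.MapsTo f K K → K = M

/-- A homeomorphism `g` is almost automorphic if there is a point `x` such that, whenever
`g ^ (n k) x` converges to some `y` for a sequence `n` of integers, then `g ^ (-n k) y`
converges to `x`. -/
def IsAlmostAutomorphic {X : Type*} [TopologicalSpace X] (g : X ≃ₜ X) : Prop :=
  ∃ x : X, ∀ (n : ℕ → ℤ) (y : X),
    Tendsto (fun k => (g ^ n k) x) atTop (𝓝 y) →
      Tendsto (fun k => (g ^ (-n k)) y) atTop (𝓝 x)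

/-- The set `M` is almost automorphic for `f`: the map `f` restricts to a homeomorphism of `M`, and
this homeomorphism is almost automorphic. -/
def IsAlmostAutomorphicSet {X : Type*} [TopologicalSpace X] (f : X → X) (M : Set X) : Prop :=
  ∃ g : M ≃ₜ M, (∀ p : M, (g p : X) = f p) ∧ IsAlmostAutomorphic g

end QPF

namespace QPF

/-! The attractor carries an invariant graph `1 / 2 + γ` that jumps along one orbit, while fibre
contraction forces the attractor onto this graph over a dense set of base points.

`exists_summable_cocycle` gives a continuous `c > 0` and summable `a` with `c (n • α) * a n = a (n +
1)`. Let `γ` jump by `a n` at `n • α`. In `γ (θ + α) - c θ * γ θ` the jumps cancel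
(`continuous_jumpSeries_add_sub`), so fibre maps with slope `c θ` near the graph depend continuously
on `θ` and preserve it.

The products of `c` along the forward orbit of `0` tend to `0`. By Baire, the products over orbit
segments ending at `θ` get arbitrarily small for densely many `θ` (`dense_contractsBackward`), and
over these the attractor is a single point. A continuous invariant curve would lie in the attractor
and agree with `1 / 2 + γ` on a dense set, against the jump at `0`. A singleton fibre also yields
the unique minimal set and its almost automorphy. -/

/-- The distance to the origin in `X`, regularised so that it varies slowly along the orbits of
the translation by `α`. -/
noncomputable def orbitDist {X : Type*} [SeminormedAddCommGroup X] (α : X) (ε L : ℝ) (θ : X) : ℝ :=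
  ⨅ j : ℤ, min 1 (‖θ + j • α‖ / ε + |(j : ℝ)| / L)

/-! ### Slowly varying distance along an orbit -/

section orbitDist

variable {X : Type*} [SeminormedAddCommGroup X] {α : X} {ε L : ℝ}

lemma orbitDist_bddBelow (hε : 0 < ε) (hL : 0 < L) (θ : X) :
    BddBelow (Set.range fun j : ℤ => min 1 (‖θ + j • α‖ / ε + |(j : ℝ)| / L)) :=
  ⟨0, by rintro _ ⟨j, rfl⟩; positivity⟩

lemma orbitDist_nonneg (hε : 0 < ε) (hL : 0 < L) (θ : X) : 0 ≤ orbitDist α ε L θ :=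
  le_ciInf fun j => by positivity

lemma orbitDist_le (hε : 0 < ε) (hL : 0 < L) (θ : X) (j : ℤ) :
    orbitDist α ε L θ ≤ min 1 (‖θ + j • α‖ / ε + |(j : ℝ)| / L) :=
  ciInf_le (orbitDist_bddBelow hε hL θ) j

lemma orbitDist_zsmul_le (hε : 0 < ε) (hL : 0 < L) (n : ℤ) :
    orbitDist α ε L (n • α) ≤ |(n : ℝ)| / L := by
  refine (orbitDist_le hε hL _ (-n)).trans ((min_le_right _ _).trans ?_)
  simp

lemma min_one_le_min_one_add {x y d : ℝ} (hd : 0 ≤ d) (h : x ≤ y + d) :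
    min 1 x ≤ min 1 y + d := by
  rcases le_total 1 y with hy | hy
  · rw [min_eq_left hy]
    linarith [min_le_left 1 x]
  · rw [min_eq_right hy]
    linarith [min_le_right 1 x]

lemma orbitDist_le_add_norm_sub (hε : 0 < ε) (hL : 0 < L) (θ θ' : X) :
    orbitDist α ε L θ ≤ orbitDist α ε L θ' + ‖θ - θ'‖ / ε := by
  rw [← sub_le_iff_le_add]
  refine le_ciInf fun j => ?_
  rw [sub_le_iff_le_add]
  refine (orbitDist_le hε hL θ j).trans (min_one_le_min_one_add (by positivity) ?_)
  have h : ‖θ + j • α‖ ≤ ‖θ' + j • α‖ + ‖θ - θ'‖ := by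
    have := norm_add_le (θ' + j • α) (θ - θ')
    rwa [show θ' + j • α + (θ - θ') = θ + j • α by abel] at this
  have := div_le_div_of_nonneg_right h hε.le
  rw [add_div] at this
  linarith

lemma continuous_orbitDist (hε : 0 < ε) (hL : 0 < L) : Continuous (orbitDist α ε L) := by
  refine (LipschitzWith.of_le_add_mul (ε⁻¹).toNNReal fun θ θ' => ?_).continuous
  rw [Real.coe_toNNReal _ (by positivity), dist_eq_norm, inv_mul_eq_div]
  exact orbitDist_le_add_norm_sub hε hL θ θ'

lemma orbitDist_le_of_add_zsmul (hε : 0 < ε) (hL : 0 < L) (θ : X) (m : ℤ) :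
    orbitDist α ε L (θ + m • α) ≤ orbitDist α ε L θ + |(m : ℝ)| / L := by
  rw [← sub_le_iff_le_add]
  refine le_ciInf fun j => ?_
  rw [sub_le_iff_le_add]
  refine (orbitDist_le hε hL _ (j - m)).trans (min_one_le_min_one_add (by positivity) ?_)
  rw [show θ + m • α + (j - m) • α = θ + j • α by rw [sub_smul]; abel, add_assoc, ← add_div]
  gcongr
  push_cast
  exact abs_sub _ _

lemma abs_orbitDist_sub_orbitDist_add (hε : 0 < ε) (hL : 0 < L) (θ : X) :
    |orbitDist α ε L θ - orbitDist α ε L (θ + α)| ≤ 1 / L := by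
  have h1 := orbitDist_le_of_add_zsmul (α := α) hε hL θ 1
  have h2 := orbitDist_le_of_add_zsmul (α := α) hε hL (θ + α) (-1)
  simp at h1 h2
  rw [abs_le, one_div]
  constructor <;> linarith

/-- Every competitor `j` costs at least `1`: through `|j| / L` if `|j| ≥ L`, which includes `j =
-n`, and otherwise through the norm, since `n + j ≠ 0` is at most `N + L` in size. -/
lemma orbitDist_zsmul_eq_one (hε : 0 < ε) (hL : 0 < L) {N : ℝ}
    (h : ∀ m : ℤ, m ≠ 0 → |(m : ℝ)| ≤ N + L → ε ≤ ‖m • α‖) {n : ℤ} (hn : L ≤ |(n : ℝ)|)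
    (hn' : |(n : ℝ)| ≤ N) : orbitDist α ε L (n • α) = 1 := by
  refine le_antisymm ((orbitDist_le hε hL _ 0).trans (min_le_left _ _)) (le_ciInf fun j => ?_)
  refine le_min le_rfl ?_
  rw [← add_smul]
  rcases le_total L |(j : ℝ)| with hj | hj
  · have : 1 ≤ |(j : ℝ)| / L := (one_le_div hL).2 hj
    have : 0 ≤ ‖(n + j) • α‖ / ε := by positivity
    linarith
  · by_cases hnj : n + j = 0
    · have : |(n : ℝ)| = |(j : ℝ)| := by
        rw [eq_neg_of_add_eq_zero_left hnj]; simp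
      have : 1 ≤ |(j : ℝ)| / L := (one_le_div hL).2 (this ▸ hn)
      have : 0 ≤ ‖(n + j) • α‖ / ε := by positivity
      linarith
    · have : 1 ≤ ‖(n + j) • α‖ / ε := by
        refine (one_le_div hε).2 (h _ hnj ?_)
        push_cast
        exact (abs_add_le _ _).trans (by linarith)
      have : 0 ≤ |(j : ℝ)| / L := by positivity
      linarith

end orbitDist

/-! ### The summable cocycle -/

lemma exists_le_norm_zsmul {X : Type*} [NormedAddCommGroup X] {α : X}
    (hα : ¬ IsOfFinAddOrder α) (N : ℝ) :
    ∃ ε : ℝ, 0 < ε ∧ ∀ m : ℤ, m ≠ 0 → |(m : ℝ)| ≤ N → ε ≤ ‖m • α‖ := by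
  have hfin : {m : ℤ | |(m : ℝ)| ≤ N}.Finite := by
    refine (Set.finite_Icc (-⌈N⌉) ⌈N⌉).subset fun m hm => ?_
    have h := abs_le.1 (show |(m : ℝ)| ≤ N from hm)
    have hN := Int.le_ceil N
    constructor
    · have : ((-⌈N⌉ : ℤ) : ℝ) ≤ m := by push_cast; linarith
      exact_mod_cast this
    · have : (m : ℝ) ≤ (⌈N⌉ : ℤ) := by linarith
      exact_mod_cast this
  have hpos : ∀ m : ℤ, ∃ δ : ℝ, 0 < δ ∧ (m ≠ 0 → δ ≤ ‖m • α‖) := fun m => by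
    by_cases hm : m = 0
    · exact ⟨1, one_pos, fun h => (h hm).elim⟩
    · refine ⟨‖m • α‖, norm_pos_iff.2 fun h => hα ?_, fun _ => le_rfl⟩
      exact isOfFinAddOrder_iff_zsmul_eq_zero.2 ⟨m, hm, h⟩
  choose δ hδ hδ' using hpos
  obtain ⟨ε, hε, h⟩ : ∃ ε > 0, ∀ m ∈ hfin.toFinset, ε ≤ δ m := by
    rcases hfin.toFinset.eq_empty_or_nonempty with he | hne
    · exact ⟨1, one_pos, by simp [he]⟩
    · obtain ⟨m, _, hm⟩ := hfin.toFinset.exists_min_image δ hne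
      exact ⟨δ m, hδ m, hm⟩
  exact ⟨ε, hε, fun m hm hmN => (h m (hfin.mem_toFinset.2 hmN)).trans (hδ' m hm)⟩

lemma summable_two_mul_succ_div_two_pow :
    Summable fun k : ℕ => 2 * ((k : ℝ) + 1) * (1 / 2 ^ k) := by
  have h1 := summable_pow_mul_geometric_of_norm_lt_one (R := ℝ) 1 (r := 1 / 2) (by norm_num)
  have h0 := summable_geometric_two
  refine ((h1.add h0).mul_left 2).congr fun k => ?_
  rw [one_div_pow]
  ring

/-- A continuous cocycle over an aperiodic translation whose products along the orbit of the
origin are summable in both time directions. -/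
theorem exists_summable_cocycle {X : Type*} [NormedAddCommGroup X] {α : X}
    (hα : ¬ IsOfFinAddOrder α) :
    ∃ (c : X → ℝ) (a : ℤ → ℝ), Continuous c ∧ (∀ θ, 0 < c θ) ∧ (∀ n, 0 < a n) ∧ Summable a ∧
      ∀ n : ℤ, c (n • α) * a n = a (n + 1) := by
  choose ε hε hε' using fun k : ℕ => exists_le_norm_zsmul hα ((2 : ℝ) ^ (k + 1) + 2 ^ k)
  -- This weight makes `exp (-b k) ≤ |n|⁻²` for `2 ^ k ≤ |n| ≤ 2 ^ (k + 1)`, and `b k / 2 ^ k` is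
  -- still summable.
  set b : ℕ → ℝ := fun k => 2 * ((k : ℝ) + 1) with hb
  have hb0 : ∀ k, 0 ≤ b k := fun k => by positivity
  have hL : ∀ k : ℕ, (0 : ℝ) < 2 ^ k := fun k => by positivity
  set w : ℕ → X → ℝ := fun k => orbitDist α (ε k) (2 ^ k)
  have hw0 : ∀ k θ, 0 ≤ w k θ := fun k θ => orbitDist_nonneg (hε k) (hL k) θ
  have hbs : Summable fun k => b k * (1 / 2 ^ k) := summable_two_mul_succ_div_two_pow
  have hsum : ∀ n : ℤ, Summable fun k => b k * w k (n • α) := fun n => by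
    refine Summable.of_nonneg_of_le (fun k => mul_nonneg (hb0 k) (hw0 k _)) (fun k => ?_)
      (hbs.mul_right |(n : ℝ)|)
    rw [mul_assoc (b k), one_div_mul_eq_div]
    exact mul_le_mul_of_nonneg_left (orbitDist_zsmul_le (hε k) (hL k) n) (hb0 k)
  -- Convergence of `∑ b k * w k` is known only on the orbit of `0`; its increments along `α` are
  -- summable uniformly in `θ`, so `c` is defined and continuous everywhere.
  refine ⟨fun θ => Real.exp (∑' k, b k * (w k θ - w k (θ + α))),
    fun n => Real.exp (-∑' k, b k * w k (n • α)), ?_, fun _ => Real.exp_pos _,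
    fun _ => Real.exp_pos _, ?_, fun n => ?_⟩
  · refine Real.continuous_exp.comp (continuous_tsum (fun k => ?_) hbs fun k θ => ?_)
    · have := continuous_orbitDist (α := α) (hε k) (hL k)
      fun_prop
    · rw [Real.norm_eq_abs, abs_mul, abs_of_nonneg (hb0 k)]
      exact mul_le_mul_of_nonneg_left (abs_orbitDist_sub_orbitDist_add (hε k) (hL k) θ) (hb0 k)
  · refine Summable.of_norm_bounded_eventually (g := fun n : ℤ => 1 / (n : ℝ) ^ 2)
      (Real.summable_one_div_int_pow.2 one_lt_two) ?_
    rw [Filter.eventually_cofinite]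
    refine (Set.finite_singleton (0 : ℤ)).subset fun n hn => ?_
    by_contra hn0
    refine hn ?_
    have hn0' : n.natAbs ≠ 0 := Int.natAbs_ne_zero.2 hn0
    set k := Nat.log 2 n.natAbs
    have habs : |(n : ℝ)| = (n.natAbs : ℝ) := by rw [Nat.cast_natAbs, Int.cast_abs]
    have h1 : (2 : ℝ) ^ k ≤ |(n : ℝ)| := by
      rw [habs]; exact_mod_cast Nat.pow_log_le_self 2 hn0'
    have h2 : |(n : ℝ)| ≤ 2 ^ (k + 1) := by
      rw [habs]; exact_mod_cast (Nat.lt_pow_succ_log_self one_lt_two _).le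
    have h3 : b k ≤ ∑' k, b k * w k (n • α) := by
      have := (hsum n).le_tsum k fun j _ => mul_nonneg (hb0 j) (hw0 j _)
      rwa [show w k (n • α) = 1 from orbitDist_zsmul_eq_one (hε k) (hL k) (hε' k) h1 h2,
        mul_one] at this
    have h4 : (2 : ℝ) ^ (k + 1) ≤ Real.exp ((k : ℝ) + 1) := by
      have : (2 : ℝ) ≤ Real.exp 1 := by linarith [Real.add_one_le_exp (1 : ℝ)]
      calc (2 : ℝ) ^ (k + 1) ≤ Real.exp 1 ^ (k + 1) := by gcongr
        _ = Real.exp ((k : ℝ) + 1) := by rw [← Real.exp_nat_mul]; simp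
    rw [Real.norm_eq_abs, abs_of_pos (Real.exp_pos _), Real.exp_neg, one_div]
    have hnpos : 0 < |(n : ℝ)| := (hL k).trans_le h1
    rw [← sq_abs]
    refine inv_anti₀ (by positivity) ?_
    calc |(n : ℝ)| ^ 2 ≤ Real.exp ((k : ℝ) + 1) ^ 2 := by gcongr; exact h2.trans h4
      _ = Real.exp (b k) := by rw [← Real.exp_nat_mul]; simp [hb]
      _ ≤ _ := Real.exp_le_exp.2 h3
  · have hn1 : n • α + α = (n + 1) • α := by rw [add_smul, one_smul]
    rw [← Real.exp_add]
    simp only [hn1, mul_sub]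
    rw [(hsum n).tsum_sub (hsum (n + 1))]
    ring_nf

/-! ### The global attractor -/

section Attractor

variable {f : Annulus → Annulus}

lemma subset_globalAttractor_of_image_eq {S : Set Annulus} (h : f '' S = S) :
    S ⊆ globalAttractor f := by
  refine Set.subset_iInter fun n => ?_
  have hn : f^[n] '' S = S := by
    induction n with
    | zero => simp
    | succ n ih => rw [Function.iterate_succ, Set.image_comp, h, ih]
  rw [← hn]
  exact Set.image_mono (Set.subset_univ _)

lemma isClosed_globalAttractor (hf : Continuous f) : IsClosed (globalAttractor f) :=
  isClosed_iInter fun n => (isCompact_univ.image (hf.iterate n)).isClosed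

lemma mapsTo_globalAttractor : Set.MapsTo f (globalAttractor f) (globalAttractor f) := by
  intro p hp
  refine Set.mem_iInter.2 fun n => ?_
  obtain ⟨q, -, rfl⟩ := Set.mem_iInter.1 hp n
  refine ⟨f q, Set.mem_univ _, ?_⟩
  rw [← Function.iterate_succ_apply, Function.iterate_succ_apply']

end Attractor

/-! ### Backward contraction and singleton fibres -/

/-- The product of `c` along the orbit segment of length `n` that ends at `θ` gets arbitrarily
small. -/
def ContractsBackward {X : Type*} [AddCommGroup X] (α : X) (c : X → ℝ) (θ : X) : Prop :=
  ∀ ε > 0, ∃ n : ℕ, ∏ i ∈ Finset.range n, c (θ - n • α + i • α) < ε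

lemma dense_contractsBackward {X : Type*} [AddCommGroup X] [TopologicalSpace X]
    [IsTopologicalAddGroup X] [BaireSpace X] {α : X} (hα : DenseRange fun n : ℕ => n • α)
    {c : X → ℝ} (hc : Continuous c) (h : Tendsto (fun n : ℕ => ∏ i ∈ Finset.range n, c (i • α))
      atTop (𝓝 0)) : Dense {θ | ContractsBackward α c θ} := by
  have hO : ∀ N : ℕ, IsOpen (⋃ n : ℕ, {θ : X |
      ∏ i ∈ Finset.range n, c (θ - n • α + i • α) < 1 / ((N : ℝ) + 1)}) := fun N =>
    isOpen_iUnion fun n => isOpen_lt (by fun_prop) continuous_const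
  have hD : ∀ N : ℕ, Dense (⋃ n : ℕ, {θ : X |
      ∏ i ∈ Finset.range n, c (θ - n • α + i • α) < 1 / ((N : ℝ) + 1)}) := fun N => by
    obtain ⟨m, hm⟩ := eventually_atTop.1
      (h.eventually_lt_const (Nat.one_div_pos_of_nat (α := ℝ) (n := N)))
    have h1 : DenseRange fun n : ℕ => m • α + n • α :=
      (Homeomorph.addLeft (m • α)).surjective.denseRange.comp hα
        (Homeomorph.addLeft (m • α)).continuous
    refine h1.mono ?_
    rintro _ ⟨n, rfl⟩
    -- The segment of length `m + n` ending at `(m + n) • α` starts at `0`, so its product is a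
    -- forward product.
    refine Set.mem_iUnion.2 ⟨m + n, ?_⟩
    simpa [← add_smul] using hm (m + n) (Nat.le_add_right _ _)
  refine (dense_iInter_of_isOpen_nat hO hD).mono fun θ hθ ε hε => ?_
  obtain ⟨N, hN⟩ := exists_nat_one_div_lt hε
  obtain ⟨n, hn⟩ := Set.mem_iUnion.1 (Set.mem_iInter.1 hθ N)
  exact ⟨n, lt_trans hn hN⟩

section SkewProduct

variable {f : Annulus → Annulus} {α : UnitAddCircle} {c : UnitAddCircle → ℝ}

lemma iterate_fst (hfst : ∀ p, (f p).1 = p.1 + α) (n : ℕ) (p : Annulus) :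
    (f^[n] p).1 = p.1 + n • α := by
  induction n with
  | zero => simp
  | succ n ih => rw [Function.iterate_succ_apply', hfst, ih, succ_nsmul, add_assoc]

lemma abs_iterate_snd_sub_le (hfst : ∀ p, (f p).1 = p.1 + α) (hc : ∀ θ, 0 < c θ)
    (hlip : ∀ θ x y, |((f (θ, x)).2 : ℝ) - (f (θ, y)).2| ≤ c θ * |(x : ℝ) - y|)
    (n : ℕ) {p q : Annulus} (hpq : p.1 = q.1) :
    |((f^[n] p).2 : ℝ) - (f^[n] q).2| ≤
      (∏ i ∈ Finset.range n, c (p.1 + i • α)) * |(p.2 : ℝ) - q.2| := by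
  induction n with
  | zero => simp
  | succ n ih =>
    rw [Function.iterate_succ_apply', Function.iterate_succ_apply', Finset.prod_range_succ,
      mul_comm (Finset.prod _ _), mul_assoc]
    have h := hlip (p.1 + n • α) (f^[n] p).2 (f^[n] q).2
    have hp : (p.1 + n • α, (f^[n] p).2) = f^[n] p := Prod.ext (iterate_fst hfst n p).symm rfl
    have hq : (p.1 + n • α, (f^[n] q).2) = f^[n] q :=
      Prod.ext (by rw [iterate_fst hfst n q, hpq]) rfl
    rw [hp, hq] at h
    exact h.trans (mul_le_mul_of_nonneg_left ih (hc _).le)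

/-- Both points are `n`-th images of points in a common fibre, at distance at most `1`; the backward
product bounds what remains of that distance. -/
lemma eq_of_mem_globalAttractor (hfst : ∀ p, (f p).1 = p.1 + α) (hc : ∀ θ, 0 < c θ)
    (hlip : ∀ θ x y, |((f (θ, x)).2 : ℝ) - (f (θ, y)).2| ≤ c θ * |(x : ℝ) - y|)
    {p q : Annulus} (hp : p ∈ globalAttractor f) (hq : q ∈ globalAttractor f)
    (hpq : p.1 = q.1) (hθ : ContractsBackward α c p.1) : p = q := by
  refine Prod.ext hpq (Subtype.ext (eq_of_forall_dist_le fun ε hε => ?_))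
  rw [Real.dist_eq]
  obtain ⟨n, hn⟩ := hθ ε hε
  obtain ⟨p', -, rfl⟩ := Set.mem_iInter.1 hp n
  obtain ⟨q', -, rfl⟩ := Set.mem_iInter.1 hq n
  rw [iterate_fst hfst] at hpq hn
  rw [iterate_fst hfst] at hpq
  rw [add_sub_cancel_right] at hn
  refine (abs_iterate_snd_sub_le hfst hc hlip n (add_right_cancel hpq)).trans ?_
  have h1 : |(p'.2 : ℝ) - q'.2| ≤ 1 := by
    have := p'.2.2.1; have := p'.2.2.2; have := q'.2.2.1; have := q'.2.2.2
    exact abs_le.2 ⟨by linarith, by linarith⟩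
  have h0 : 0 ≤ ∏ i ∈ Finset.range n, c (p'.1 + i • α) := Finset.prod_nonneg fun _ _ => (hc _).le
  nlinarith [abs_nonneg ((p'.2 : ℝ) - q'.2)]

end SkewProduct

/-! ### Almost automorphy and the minimal set -/

lemma zpow_semiconj_add_zsmul {X G : Type*} [TopologicalSpace X] [AddCommGroup G] {α : G}
    (g : X ≃ₜ X) {φ : X → G} (h : ∀ p, φ (g p) = φ p + α) (m : ℤ) (p : X) :
    φ ((g ^ m) p) = φ p + m • α := by
  induction m with
  | zero => simp
  | succ n ih =>
    rw [add_comm (n : ℤ) 1, zpow_one_add]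
    change φ (g ((g ^ (n : ℤ)) p)) = _
    rw [h, ih, add_smul, one_smul]
    abel
  | pred n ih =>
    have : g ^ (-(n : ℤ)) = g * g ^ (-(n : ℤ) - 1) := by
      rw [← zpow_one_add]; congr 1; ring
    rw [this] at ih
    change φ (g ((g ^ (-(n : ℤ) - 1)) p)) = _ at ih
    rw [h] at ih
    rw [sub_smul, one_smul, eq_sub_of_add_eq ih]
    abel

/-- A homeomorphism of a compact space that factors onto a translation is almost automorphic
as soon as some fibre of the factor map is a singleton. -/
lemma isAlmostAutomorphic_of_semiconj {X G : Type*} [TopologicalSpace X] [CompactSpace X]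
    [AddCommGroup G] [TopologicalSpace G] [IsTopologicalAddGroup G] [T2Space G] {α : G}
    (g : X ≃ₜ X) {φ : X → G} (hφ : Continuous φ) (h : ∀ p, φ (g p) = φ p + α)
    {x : X} (hx : ∀ y, φ y = φ x → y = x) : IsAlmostAutomorphic g := by
  -- By compactness it suffices to identify cluster points. In the translation factor the backward
  -- orbit returns to `φ x`, so each one lies in the fibre of `x`.
  refine ⟨x, fun n y hy => le_nhds_of_unique_clusterPt fun z hz => hx z ?_⟩
  have h1 : Tendsto (fun k => φ x + n k • α) atTop (𝓝 (φ y)) := by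
    simpa only [Function.comp_def, zpow_semiconj_add_zsmul g h] using (hφ.tendsto y).comp hy
  have h2 : Tendsto (fun k => φ ((g ^ (-n k)) y)) atTop (𝓝 (φ x)) := by
    have := (tendsto_const_nhds (x := φ y + φ x)).sub h1
    rw [add_sub_cancel_left] at this
    refine this.congr fun k => ?_
    rw [zpow_semiconj_add_zsmul g h, neg_smul]
    abel
  have h3 : ClusterPt (φ z) (map (fun k => φ ((g ^ (-n k)) y)) atTop) :=
    ClusterPt.map hz hφ.continuousAt tendsto_map
  exact eq_of_nhds_neBot (h3.mono h2)

/-- A nonempty closed forward invariant subset of the attractor projects onto the circle, so it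
meets the singleton fibre and contains `p₀`. Hence the orbit closure of `p₀` lies in every such set.
-/
lemma exists_isMinimalSet_isAlmostAutomorphicSet {f : Annulus → Annulus} {α : UnitAddCircle}
    (hα : DenseRange fun n : ℕ => n • α) (hf : Continuous f) (hinj : Function.Injective f)
    (hfst : ∀ p, (f p).1 = p.1 + α) {p₀ : Annulus} (hp₀ : p₀ ∈ globalAttractor f)
    (huniq : ∀ p ∈ globalAttractor f, p.1 = p₀.1 → p = p₀) :
    ∃ M : Set Annulus, M ⊆ globalAttractor f ∧ IsMinimalSet f M ∧ IsAlmostAutomorphicSet f M ∧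
      ∀ M' : Set Annulus, M' ⊆ globalAttractor f → IsMinimalSet f M' → M' = M := by
  set O : Set Annulus := Set.range fun n : ℕ => f^[n] p₀
  set M : Set Annulus := closure O
  have hp₀O : p₀ ∈ O := ⟨0, rfl⟩
  have hMA : M ⊆ globalAttractor f := by
    refine closure_minimal ?_ (isClosed_globalAttractor hf)
    rintro _ ⟨n, rfl⟩
    exact mapsTo_globalAttractor.iterate n hp₀
  have hmaps : Set.MapsTo f M M := by
    refine Set.MapsTo.closure ?_ hf
    rintro _ ⟨n, rfl⟩
    exact ⟨n + 1, Function.iterate_succ_apply' f n p₀⟩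
  have hmem : ∀ K : Set Annulus, K ⊆ globalAttractor f → K.Nonempty → IsClosed K →
      Set.MapsTo f K K → M ⊆ K := by
    rintro K hKA ⟨q, hq⟩ hK hKK
    have hdense : DenseRange fun n : ℕ => q.1 + n • α :=
      (Homeomorph.addLeft q.1).surjective.denseRange.comp hα (Homeomorph.addLeft q.1).continuous
    have hcl : IsClosed (Prod.fst '' K) := (hK.isCompact.image continuous_fst).isClosed
    have hp₀K : p₀.1 ∈ Prod.fst '' K := by
      refine closure_minimal ?_ hcl (hdense p₀.1)
      rintro _ ⟨n, rfl⟩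
      exact ⟨f^[n] q, hKK.iterate n hq, iterate_fst hfst n q⟩
    obtain ⟨p, hpK, hp⟩ := hp₀K
    have hpp : p₀ ∈ K := huniq p (hKA hpK) hp ▸ hpK
    refine closure_minimal ?_ hK
    rintro _ ⟨n, rfl⟩
    exact hKK.iterate n hpp
  have hmin : IsMinimalSet f M :=
    ⟨⟨p₀, subset_closure hp₀O⟩, isClosed_closure, hmaps, fun K hKM hne hK hKK =>
      hKM.antisymm (hmem K (hKM.trans hMA) hne hK hKK)⟩
  have himage : f '' M = M := by
    refine hmin.2.2.2 _ (Set.image_subset_iff.2 hmaps) (hmin.1.image f)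
      (isClosed_closure.isCompact.image hf).isClosed ?_
    rintro _ ⟨q, hq, rfl⟩
    exact ⟨f q, hmaps hq, rfl⟩
  have hbij : Function.Bijective (hmaps.restrict f M M) :=
    ⟨hmaps.restrict_inj.2 hinj.injOn, by
      rintro ⟨q, hq⟩
      obtain ⟨p, hp, rfl⟩ := himage.symm ▸ hq
      exact ⟨⟨p, hp⟩, rfl⟩⟩
  have : CompactSpace M := isCompact_iff_compactSpace.1 isClosed_closure.isCompact
  refine ⟨M, hMA, hmin, ⟨Continuous.homeoOfEquivCompactToT2
    (f := Equiv.ofBijective _ hbij) (hf.restrict hmaps), fun p => rfl, ?_⟩, fun M' hM'A hM' => ?_⟩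
  · refine isAlmostAutomorphic_of_semiconj (φ := fun p : M => p.1.1) (α := α) _
      (continuous_fst.comp continuous_subtype_val) (fun p => hfst p)
      (x := ⟨p₀, subset_closure hp₀O⟩) fun y hy => Subtype.ext (huniq y (hMA y.2) hy)
  · exact (hM'.2.2.2 M (hmem M' hM'A hM'.1 hM'.2.1 hM'.2.2.1) hmin.1 isClosed_closure hmaps).symm

/-! ### Sawtooth series with jumps along an orbit -/

/-- The sawtooth function: the representative in `[0, 1)` of a point of the circle. -/
noncomputable def sawtooth (θ : UnitAddCircle) : ℝ := (AddCircle.equivIco 1 0 θ : ℝ)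

lemma sawtooth_nonneg (θ : UnitAddCircle) : 0 ≤ sawtooth θ := (AddCircle.equivIco 1 0 θ).2.1

lemma sawtooth_le_one (θ : UnitAddCircle) : sawtooth θ ≤ 1 :=
  (AddCircle.equivIco 1 0 θ).2.2.le.trans (by simp)

lemma continuousAt_sawtooth {θ : UnitAddCircle} (h : θ ≠ 0) : ContinuousAt sawtooth θ :=
  continuousAt_subtype_val.comp (AddCircle.continuousAt_equivIco 1 0 (by simpa using h))

lemma sawtooth_coe {x : ℝ} (h0 : 0 ≤ x) (h1 : x < 1) : sawtooth (x : UnitAddCircle) = x :=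
  AddCircle.equivIco_coe_of_mem ⟨h0, by simpa using h1⟩

lemma sawtooth_coe_of_neg {x : ℝ} (h0 : x < 0) (h1 : -1 ≤ x) :
    sawtooth (x : UnitAddCircle) = x + 1 := by
  have : (x : UnitAddCircle) = ((x + 1 : ℝ) : UnitAddCircle) := by
    rw [AddCircle.coe_add, AddCircle.coe_period, add_zero]
  rw [this, sawtooth_coe (by linarith) (by linarith)]

/-- The sawtooth function does not agree on any dense set with a function that is continuous at
its jump. -/
lemma not_eqOn_sawtooth {r : UnitAddCircle → ℝ} (hr : ContinuousAt r 0) {G : Set UnitAddCircle}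
    (hG : Dense G) : ¬ Set.EqOn r sawtooth G := by
  intro h
  have hr' : ContinuousAt (fun t : ℝ => r (t : UnitAddCircle)) 0 :=
    ContinuousAt.comp (f := fun t : ℝ => (t : UnitAddCircle)) (by simpa using hr)
      (AddCircle.continuous_mk' 1).continuousAt
  obtain ⟨δ, hδ, hδ'⟩ := Metric.continuousAt_iff.1 hr' (1 / 4) (by norm_num)
  have hD : Dense ((fun t : ℝ => (t : UnitAddCircle)) ⁻¹' G) :=
    hG.preimage QuotientAddGroup.isOpenMap_coe
  have hmin : 0 < min δ (1 / 4) := lt_min hδ (by norm_num)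
  -- The sawtooth is below `1 / 4` at `t > 0` and above `3 / 4` at `s < 0`, while `r t` and `r s`
  -- differ by less than `1 / 2`.
  obtain ⟨t, ht, ht0, htδ⟩ := hD.exists_between hmin
  obtain ⟨s, hs, hsδ, hs0⟩ := hD.exists_between (neg_lt_zero.2 hmin)
  have hm1 := min_le_left δ (1 / 4)
  have hm2 := min_le_right δ (1 / 4)
  have h1 := hδ' (x := t) (by rw [Real.dist_eq, sub_zero, abs_of_pos ht0]; linarith)
  have h2 := hδ' (x := s) (by rw [Real.dist_eq, sub_zero, abs_of_neg hs0]; linarith)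
  rw [h ht, sawtooth_coe ht0.le (by linarith), Real.dist_eq, abs_lt] at h1
  rw [h hs, sawtooth_coe_of_neg hs0 (by linarith), Real.dist_eq, abs_lt] at h2
  linarith [h1.2, h2.1, h1.1, h2.2]

/-- A superposition of sawtooth functions is continuous wherever the coefficients of the jumps
vanish. -/
lemma continuousAt_tsum_mul_sawtooth {α : UnitAddCircle} {d : ℤ → UnitAddCircle → ℝ} {u : ℤ → ℝ}
    (hd : ∀ n, Continuous (d n)) (hu : Summable u) (hdu : ∀ n θ, |d n θ| ≤ u n)
    {θ₀ : UnitAddCircle} (h0 : ∀ n : ℤ, θ₀ = n • α → d n θ₀ = 0) :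
    ContinuousAt (fun θ => ∑' n : ℤ, d n θ * sawtooth (θ - n • α)) θ₀ := by
  have hle : ∀ n θ, |d n θ * sawtooth (θ - n • α)| ≤ |d n θ| := fun n θ => by
    rw [abs_mul, abs_of_nonneg (sawtooth_nonneg _)]
    exact mul_le_of_le_one_right (abs_nonneg _) (sawtooth_le_one _)
  refine tendsto_tsum_of_dominated_convergence hu (fun n => ?_)
    (Eventually.of_forall fun θ n => (hle n θ).trans (hdu n θ))
  by_cases hn : θ₀ = n • α
  · rw [h0 n hn, zero_mul]
    have : Tendsto (fun θ => |d n θ|) (𝓝 θ₀) (𝓝 0) := by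
      simpa [h0 n hn] using ((hd n).tendsto θ₀).abs
    exact squeeze_zero_norm (hle n) this
  · have h1 : ContinuousAt (fun θ => sawtooth (θ - n • α)) θ₀ :=
      ContinuousAt.comp (f := fun θ => θ - n • α) (continuousAt_sawtooth (sub_ne_zero.2 hn))
        (by fun_prop)
    exact (hd n).continuousAt.mul h1

section JumpSeries

variable {α : UnitAddCircle} {a : ℤ → ℝ}

/-- The function with a jump of size `a n` at `n • α`, for every integer `n`. -/
noncomputable def jumpSeries (α : UnitAddCircle) (a : ℤ → ℝ) (θ : UnitAddCircle) : ℝ :=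
  ∑' n : ℤ, a n * sawtooth (θ - n • α)

lemma summable_jumpSeries (ha : ∀ n, 0 < a n) (hs : Summable a) (θ : UnitAddCircle) :
    Summable fun n : ℤ => a n * sawtooth (θ - n • α) :=
  hs.of_nonneg_of_le (fun n => mul_nonneg (ha n).le (sawtooth_nonneg _))
    fun n => mul_le_of_le_one_right (ha n).le (sawtooth_le_one _)

lemma jumpSeries_nonneg (ha : ∀ n, 0 < a n) (θ : UnitAddCircle) : 0 ≤ jumpSeries α a θ :=
  tsum_nonneg fun n => mul_nonneg (ha n).le (sawtooth_nonneg _)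

lemma jumpSeries_le (ha : ∀ n, 0 < a n) (hs : Summable a) (θ : UnitAddCircle) :
    jumpSeries α a θ ≤ ∑' n, a n :=
  (summable_jumpSeries ha hs θ).tsum_le_tsum
    (fun n => mul_le_of_le_one_right (ha n).le (sawtooth_le_one _)) hs

lemma jumpSeries_add (θ : UnitAddCircle) :
    jumpSeries α a (θ + α) = ∑' n : ℤ, a (n + 1) * sawtooth (θ - n • α) := by
  rw [jumpSeries, ← (Equiv.addRight (1 : ℤ)).tsum_eq]
  refine tsum_congr fun n => ?_
  rw [Equiv.coe_addRight, add_smul, one_smul, add_sub_add_right_eq_sub]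

/-- The jump at `n • α` has coefficient `a (n + 1) - c θ * a n`, which the cocycle relation makes
vanish exactly there. -/
lemma continuous_jumpSeries_add_sub {c : UnitAddCircle → ℝ} (hc : Continuous c)
    (hc0 : ∀ θ, 0 < c θ) {C : ℝ} (hC : ∀ θ, c θ ≤ C) (ha : ∀ n, 0 < a n) (hs : Summable a)
    (hca : ∀ n : ℤ, c (n • α) * a n = a (n + 1)) :
    Continuous fun θ => jumpSeries α a (θ + α) - c θ * jumpSeries α a θ := by
  have hs1 : Summable fun n : ℤ => a (n + 1) := (Equiv.addRight (1 : ℤ)).summable_iff.2 hs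
  have heq : (fun θ => jumpSeries α a (θ + α) - c θ * jumpSeries α a θ) =
      fun θ => ∑' n : ℤ, (a (n + 1) - c θ * a n) * sawtooth (θ - n • α) := by
    funext θ
    rw [jumpSeries_add, jumpSeries, ← tsum_mul_left, ← Summable.tsum_sub]
    · exact tsum_congr fun n => by ring
    · exact hs1.of_nonneg_of_le (fun n => mul_nonneg (ha _).le (sawtooth_nonneg _))
        fun n => mul_le_of_le_one_right (ha _).le (sawtooth_le_one _)
    · exact (summable_jumpSeries ha hs θ).mul_left _
  rw [heq]
  refine continuous_iff_continuousAt.2 fun θ₀ => continuousAt_tsum_mul_sawtooth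
    (fun n => by fun_prop) (hs1.add (hs.mul_left C)) (fun n θ => ?_) fun n hn => ?_
  · have h1 := ha n
    have h2 := ha (n + 1)
    have h3 := mul_le_mul_of_nonneg_right (hC θ) h1.le
    have h4 := mul_pos (hc0 θ) h1
    exact abs_le.2 ⟨by linarith, by linarith⟩
  · rw [hn, hca, sub_self]

/-- Aperiodicity keeps every other jump away from `0`, which isolates a single jump of size `a 0`.
-/
lemma continuousAt_jumpSeries_sub (hα : ¬ IsOfFinAddOrder α) (ha : ∀ n, 0 < a n)
    (hs : Summable a) : ContinuousAt (fun θ => jumpSeries α a θ - a 0 * sawtooth θ) 0 := by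
  have heq : (fun θ => jumpSeries α a θ - a 0 * sawtooth θ) =
      fun θ => ∑' n : ℤ, (if n = 0 then 0 else a n) * sawtooth (θ - n • α) := by
    funext θ
    rw [jumpSeries, (summable_jumpSeries ha hs θ).tsum_eq_add_tsum_ite 0, zero_smul, sub_zero,
      add_sub_cancel_left]
    exact tsum_congr fun n => by split_ifs <;> simp
  rw [heq]
  refine continuousAt_tsum_mul_sawtooth (d := fun n _ => if n = 0 then 0 else a n)
    (fun n => continuous_const) hs (fun n θ => ?_) fun n hn => ?_
  · split_ifs
    · simpa using (ha n).le
    · rw [abs_of_pos (ha n)]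
  · rw [if_pos]
    by_contra h
    exact hα (isOfFinAddOrder_iff_zsmul_eq_zero.2 ⟨n, h, hn.symm⟩)

end JumpSeries

/-! ### Fibre maps -/

/-- A strictly increasing map that is the identity on `[0, K]` and has slope `t` elsewhere. -/
noncomputable def softClamp (t K x : ℝ) : ℝ := t * x + (1 - t) * max 0 (min K x)

section softClamp

variable {t K : ℝ}

lemma continuous_softClamp : Continuous (softClamp t K) := by
  unfold softClamp; fun_prop

lemma softClamp_of_mem {x : ℝ} (h0 : 0 ≤ x) (hK : x ≤ K) : softClamp t K x = x := by
  rw [softClamp, min_eq_right hK, max_eq_right h0]; ring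

lemma clamp_sub_clamp {x y : ℝ} (h : x ≤ y) :
    0 ≤ max 0 (min K y) - max 0 (min K x) ∧ max 0 (min K y) - max 0 (min K x) ≤ y - x := by
  constructor
  · exact sub_nonneg.2 (max_le_max_left _ (min_le_min_left _ h))
  · rcases max_cases 0 (min K y) with h1 | h1 <;> rcases max_cases 0 (min K x) with h2 | h2 <;>
      rcases min_cases K y with h3 | h3 <;> rcases min_cases K x with h4 | h4 <;> linarith

lemma strictMono_softClamp (ht : 0 < t) (ht1 : t ≤ 1) : StrictMono (softClamp t K) := by
  intro x y h
  have h1 := mul_nonneg (sub_nonneg.2 ht1) (clamp_sub_clamp (K := K) h.le).1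
  have h2 := mul_pos ht (sub_pos.2 h)
  unfold softClamp
  linarith

lemma abs_softClamp_sub_le (ht : 0 < t) (ht1 : t ≤ 1) (x y : ℝ) :
    |softClamp t K x - softClamp t K y| ≤ |x - y| := by
  wlog h : y ≤ x generalizing x y
  · rw [abs_sub_comm, abs_sub_comm x]
    exact this y x (le_of_not_ge h)
  rw [abs_of_nonneg (sub_nonneg.2 h),
    abs_of_nonneg (sub_nonneg.2 ((strictMono_softClamp ht ht1).monotone h))]
  have h1 := mul_le_mul_of_nonneg_left (clamp_sub_clamp (K := K) h).2 (sub_nonneg.2 ht1)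
  unfold softClamp
  linarith

lemma softClamp_mem (ht : 0 < t) (ht1 : t ≤ 1) (hK : 0 ≤ K) {x r : ℝ} (hx : |x| ≤ r) :
    softClamp t K x ∈ Set.Icc (-(t * r)) (t * r + K) := by
  have hx := abs_le.1 hx
  have h1 : 0 ≤ max 0 (min K x) := le_max_left _ _
  have h2 : max 0 (min K x) ≤ K := max_le hK (min_le_left _ _)
  have h3 := mul_nonneg (sub_nonneg.2 ht1) h1
  have h4 := mul_le_mul_of_nonneg_left hx.1 ht.le
  have h5 := mul_le_mul_of_nonneg_left hx.2 ht.le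
  have h6 := mul_nonneg ht.le h1
  unfold softClamp
  constructor <;> linarith

end softClamp

lemma mem_annulusInterior {p : Annulus} (h0 : 0 < (p.2 : ℝ)) (h1 : (p.2 : ℝ) < 1) :
    p ∈ annulusInterior := by
  change (p.1, (p.2 : ℝ)) ∈ interior _
  rw [interior_prod_eq, interior_univ, interior_Icc]
  exact ⟨Set.mem_univ _, h0, h1⟩

/-- The fibre maps, on the real line, of the skew product that is affine near the invariant
function `1 / 2 + jumpSeries α a` and strongly contracting away from it. -/
noncomputable def fibreMap (α : UnitAddCircle) (a : ℤ → ℝ) (c : UnitAddCircle → ℝ) (t K : ℝ)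
    (θ : UnitAddCircle) (x : ℝ) : ℝ :=
  1 / 2 + (jumpSeries α a (θ + α) - c θ * jumpSeries α a θ) + c θ * softClamp t K (x - 1 / 2)

lemma fibreMap_jumpSeries {α : UnitAddCircle} {a : ℤ → ℝ} {c : UnitAddCircle → ℝ} {t K : ℝ}
    {θ : UnitAddCircle} (h0 : 0 ≤ jumpSeries α a θ) (hK : jumpSeries α a θ ≤ K) :
    fibreMap α a c t K θ (1 / 2 + jumpSeries α a θ) = 1 / 2 + jumpSeries α a (θ + α) := by
  rw [fibreMap, add_sub_cancel_left, softClamp_of_mem h0 hK]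
  ring

/-- The image is `1 / 2 + γ (θ + α)` plus `c θ` times a deviation of at most `3 / (16 * C)`, so it
is within `1 / 4` of `1 / 2`. -/
lemma fibreMap_mem_Ioo {α : UnitAddCircle} {a : ℤ → ℝ} {c : UnitAddCircle → ℝ} {C : ℝ}
    (hC1 : 1 ≤ C) (hC : ∀ θ, c θ ≤ C) (hc0 : ∀ θ, 0 < c θ)
    (h0 : ∀ θ, 0 ≤ jumpSeries α a θ) (hK : ∀ θ, jumpSeries α a θ ≤ 1 / (16 * C))
    (θ : UnitAddCircle) {x : ℝ} (hx : x ∈ Set.Icc (0 : ℝ) 1) :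
    fibreMap α a c (1 / (4 * C)) (1 / (16 * C)) θ x ∈ Set.Ioo (0 : ℝ) 1 := by
  have hCpos : 0 < C := by linarith
  have ht1 : 1 / (4 * C) ≤ 1 := by rw [div_le_one (by positivity)]; linarith
  have hK1 : 1 / (16 * C) ≤ 1 / 16 := one_div_le_one_div_of_le (by norm_num) (by linarith)
  have hx' : |x - 1 / 2| ≤ 1 / 2 := abs_le.2 ⟨by linarith [hx.1], by linarith [hx.2]⟩
  have hs := softClamp_mem (t := 1 / (4 * C)) (K := 1 / (16 * C)) (by positivity) ht1
    (by positivity) hx'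
  have hdev : |softClamp (1 / (4 * C)) (1 / (16 * C)) (x - 1 / 2) - jumpSeries α a θ| ≤
      3 / 16 / C := by
    have e1 : 1 / (4 * C) * (1 / 2) = 2 / 16 / C := by field_simp; norm_num
    have e2 : 1 / (16 * C) = 1 / 16 / C := by field_simp
    have e3 : 3 / 16 / C = 2 / 16 / C + 1 / 16 / C := by ring
    have h1 := hs.1
    have h2 := hs.2
    have h3 := hK θ
    have h4 := h0 θ
    rw [e1] at h1 h2
    rw [abs_le]
    constructor
    · linarith
    · linarith
  have hmul : |c θ * (softClamp (1 / (4 * C)) (1 / (16 * C)) (x - 1 / 2) - jumpSeries α a θ)| ≤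
      3 / 16 := by
    rw [abs_mul, abs_of_pos (hc0 θ)]
    calc _ ≤ C * (3 / 16 / C) := mul_le_mul (hC θ) hdev (abs_nonneg _) hCpos.le
      _ = 3 / 16 := by field_simp
  rw [mul_sub] at hmul
  have hmul := abs_le.1 hmul
  have h5 := h0 (θ + α)
  have h6 := hK (θ + α)
  unfold fibreMap
  constructor <;> linarith

/-! ### Orbit products, density of orbits, normalisation -/

lemma tendsto_prod_range_of_cocycle {X : Type*} [AddCommGroup X] {α : X} {c : X → ℝ} {a : ℤ → ℝ}
    (ha : ∀ n, 0 < a n) (hs : Summable a) (hca : ∀ n : ℤ, c (n • α) * a n = a (n + 1)) :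
    Tendsto (fun n : ℕ => ∏ i ∈ Finset.range n, c (i • α)) atTop (𝓝 0) := by
  have hprod : ∀ n : ℕ, ∏ i ∈ Finset.range n, c (i • α) = a n / a 0 := fun n => by
    induction n with
    | zero => simp [(ha 0).ne']
    | succ n ih =>
      have h := hca n
      rw [natCast_zsmul] at h
      rw [Finset.prod_range_succ, ih, div_mul_eq_mul_div, mul_comm, h]
      push_cast
      rfl
  simp only [hprod]
  have h0 : Tendsto (fun n : ℕ => a n) atTop (𝓝 0) :=
    (hs.comp_injective Nat.cast_injective).tendsto_atTop_zero
  simpa using h0.div_const (a 0)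

lemma denseRange_nsmul_of_not_isOfFinAddOrder {α : UnitAddCircle} (hα : ¬ IsOfFinAddOrder α) :
    DenseRange fun n : ℕ => n • α := by
  rw [← denseRange_zsmul_iff_nsmul, AddCircle.denseRange_zsmul_iff]
  exact addOrderOf_eq_zero hα

lemma not_isOfFinAddOrder_coe {ω : ℝ} (hω : Irrational ω) :
    ¬ IsOfFinAddOrder (ω : UnitAddCircle) := by
  rw [← addOrderOf_eq_zero_iff, ← AddCircle.denseRange_zsmul_iff,
    AddCircle.denseRange_zsmul_coe_iff]
  simpa using hω

/-- The cocycle relation is linear in `a`, so `a` can be rescaled until `γ` fits in the range where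
the soft clamp is the identity. -/
lemma exists_bounded_cocycle_with_small_sum {α : UnitAddCircle} (hα : ¬ IsOfFinAddOrder α) :
    ∃ (c : UnitAddCircle → ℝ) (a : ℤ → ℝ) (C : ℝ), Continuous c ∧ (∀ θ, 0 < c θ) ∧ 1 ≤ C ∧
      (∀ θ, c θ ≤ C) ∧ (∀ n, 0 < a n) ∧ Summable a ∧ ∑' n, a n = 1 / (16 * C) ∧
      ∀ n : ℤ, c (n • α) * a n = a (n + 1) := by
  obtain ⟨c, a, hc, hc0, ha, hs, hca⟩ := exists_summable_cocycle hα
  obtain ⟨C₀, hC₀⟩ := (isCompact_univ.image hc).bddAbove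
  have hA : 0 < ∑' n, a n := hs.tsum_pos (fun n => (ha n).le) 0 (ha 0)
  have hC1 : 1 ≤ max 1 C₀ := le_max_left _ _
  have hr : 0 < 1 / (16 * max 1 C₀) / ∑' n, a n := by positivity
  refine ⟨c, fun n => 1 / (16 * max 1 C₀) / (∑' n, a n) * a n, max 1 C₀, hc, hc0, hC1,
    fun θ => (hC₀ ⟨θ, Set.mem_univ _, rfl⟩).trans (le_max_right _ _),
    fun n => mul_pos hr (ha n), hs.mul_left _, ?_, fun n => ?_⟩
  · rw [tsum_mul_left, div_mul_cancel₀ _ hA.ne']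
  · change c (n • α) * (_ * a n) = _ * a (n + 1)
    rw [← hca n]; ring

end QPF

/-! ### Assembling the example -/

open QPF in
theorem corollaryc :
    ∃ f : QPF.Annulus → QPF.Annulus,
      QPF.IsQPFIncreasing f ∧
      (¬ ∃ Γ : Set QPF.Annulus, QPF.IsInvariantCurve f Γ) ∧
      Set.range f ⊆ QPF.annulusInterior ∧
      QPF.IsPinched (QPF.globalAttractor f) ∧
      ∃ M : Set QPF.Annulus,
        M ⊆ QPF.globalAttractor f ∧ QPF.IsMinimalSet f M ∧ QPF.IsAlmostAutomorphicSet f M ∧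
        ∀ M' : Set QPF.Annulus,
          M' ⊆ QPF.globalAttractor f → QPF.IsMinimalSet f M' → M' = M := by
  set α : UnitAddCircle := ((√2 : ℝ) : UnitAddCircle)
  have hα : ¬ IsOfFinAddOrder α := not_isOfFinAddOrder_coe irrational_sqrt_two
  have hdense := denseRange_nsmul_of_not_isOfFinAddOrder hα
  obtain ⟨c, a, C, hc, hc0, hC1, hC, ha, hs, hsum, hca⟩ := exists_bounded_cocycle_with_small_sum hα
  have hCpos : 0 < C := by linarith
  have ht : 0 < 1 / (4 * C) := by positivity
  have ht1 : 1 / (4 * C) ≤ 1 := by rw [div_le_one (by positivity)]; linarith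
  set γ := jumpSeries α a with hγ
  have hγ0 : ∀ θ, 0 ≤ γ θ := jumpSeries_nonneg ha
  have hγK : ∀ θ, γ θ ≤ 1 / (16 * C) := fun θ => hsum ▸ jumpSeries_le ha hs θ
  set Φ := fibreMap α a c (1 / (4 * C)) (1 / (16 * C)) with hΦ
  have hΦmem : ∀ θ (x : Set.Icc (0 : ℝ) 1), Φ θ x ∈ Set.Ioo (0 : ℝ) 1 := fun θ x =>
    fibreMap_mem_Ioo hC1 hC hc0 hγ0 hγK θ x.2
  set f : Annulus → Annulus := fun p =>
    (p.1 + α, ⟨Φ p.1 p.2, Set.Ioo_subset_Icc_self (hΦmem p.1 p.2)⟩)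
  have hfst : ∀ p, (f p).1 = p.1 + α := fun p => rfl
  have hf : Continuous f := by
    have h1 := continuous_jumpSeries_add_sub hc hc0 hC ha hs hca
    have h2 : Continuous fun p : Annulus => Φ p.1 p.2 := by
      have h3 := continuous_softClamp (t := 1 / (4 * C)) (K := 1 / (16 * C))
      exact (continuous_const.add (h1.comp continuous_fst)).add
        ((hc.comp continuous_fst).mul (h3.comp (by fun_prop)))
    exact (by fun_prop : Continuous fun p : Annulus => p.1 + α).prodMk (h2.subtype_mk _)
  have hmono : ∀ θ : UnitAddCircle, StrictMono fun x : Set.Icc (0 : ℝ) 1 => (f (θ, x)).2 := by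
    intro θ x y hxy
    refine Subtype.mk_lt_mk.2 ((add_lt_add_iff_left _).2 (mul_lt_mul_of_pos_left ?_ (hc0 θ)))
    exact strictMono_softClamp ht ht1 (sub_lt_sub_right (Subtype.coe_lt_coe.2 hxy) _)
  have hinj : Function.Injective f := by
    rintro ⟨θ, x⟩ ⟨θ', y⟩ h
    obtain rfl : θ = θ' := add_right_cancel (congrArg Prod.fst h)
    exact congrArg _ ((hmono θ).injective (congrArg Prod.snd h))
  have hlip : ∀ θ x y, |((f (θ, x)).2 : ℝ) - (f (θ, y)).2| ≤ c θ * |(x : ℝ) - y| := by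
    intro θ x y
    change |Φ θ x - Φ θ y| ≤ _
    rw [hΦ, fibreMap, fibreMap, add_sub_add_left_eq_sub, ← mul_sub, abs_mul, abs_of_pos (hc0 θ)]
    refine mul_le_mul_of_nonneg_left ((abs_softClamp_sub_le ht ht1 _ _).trans_eq ?_) (hc0 θ).le
    rw [sub_sub_sub_cancel_right]
  have hγmem : ∀ θ, 1 / 2 + γ θ ∈ Set.Icc (0 : ℝ) 1 := fun θ => by
    have h1 : 1 / (16 * C) ≤ 1 / 16 := one_div_le_one_div_of_le (by norm_num) (by linarith)
    exact ⟨by linarith [hγ0 θ], by linarith [hγK θ]⟩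
  set G : UnitAddCircle → Annulus := fun θ => (θ, ⟨1 / 2 + γ θ, hγmem θ⟩) with hG
  have hGf : ∀ θ, f (G θ) = G (θ + α) := fun θ =>
    Prod.ext rfl (Subtype.ext (fibreMap_jumpSeries (hγ0 θ) (hγK θ)))
  have hGA : ∀ θ, G θ ∈ globalAttractor f := by
    have himage : f '' Set.range G = Set.range G := by
      refine Set.Subset.antisymm ?_ ?_
      · rintro _ ⟨_, ⟨θ, rfl⟩, rfl⟩
        exact ⟨θ + α, (hGf θ).symm⟩
      · rintro _ ⟨θ, rfl⟩
        exact ⟨G (θ - α), ⟨_, rfl⟩, by rw [hGf, sub_add_cancel]⟩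
    exact fun θ => subset_globalAttractor_of_image_eq himage ⟨θ, rfl⟩
  have hcontr : Dense {θ | ContractsBackward α c θ} :=
    dense_contractsBackward hdense hc (tendsto_prod_range_of_cocycle ha hs hca)
  have huniq : ∀ θ, ContractsBackward α c θ → ∀ p ∈ globalAttractor f, p.1 = θ → p = G θ :=
    fun θ hθ p hp hpθ =>
      eq_of_mem_globalAttractor hfst hc0 hlip hp (hGA θ) hpθ (hpθ.symm ▸ hθ)
  obtain ⟨θ₀, hθ₀⟩ := hcontr.nonempty
  refine ⟨f, ⟨hf, ⟨√2, irrational_sqrt_two, hfst⟩, hmono⟩, ?_, ?_, ⟨θ₀, ?_⟩,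
    exists_isMinimalSet_isAlmostAutomorphicSet hdense hf hinj hfst (hGA θ₀) (huniq θ₀ hθ₀)⟩
  · rintro ⟨Γ, himage, g, hg, rfl⟩
    have hsub := subset_globalAttractor_of_image_eq himage
    -- Solving `g = 1 / 2 + γ` for the sawtooth gives a function continuous at `0` that equals it on
    -- the dense contracting set.
    have hcont : ContinuousAt (fun θ =>
        ((g θ : ℝ) - 1 / 2 - (γ θ - a 0 * sawtooth θ)) / a 0) 0 :=
      (((continuous_subtype_val.comp hg).continuousAt.sub continuousAt_const).sub
        (continuousAt_jumpSeries_sub hα ha hs)).div_const _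
    refine not_eqOn_sawtooth hcont hcontr fun θ hθ => ?_
    have h := congrArg (fun p : Annulus => (p.2 : ℝ)) (huniq θ hθ (θ, g θ) (hsub ⟨θ, rfl⟩) rfl)
    have h' : (g θ : ℝ) = 1 / 2 + γ θ := h
    change ((g θ : ℝ) - 1 / 2 - (γ θ - a 0 * sawtooth θ)) / a 0 = sawtooth θ
    rw [h', div_eq_iff (ha 0).ne']
    ring
  · rintro _ ⟨p, rfl⟩
    exact mem_annulusInterior (hΦmem p.1 p.2).1 (hΦmem p.1 p.2).2
  · refine Set.encard_eq_one.2 ⟨(G θ₀).2, Set.eq_singleton_iff_unique_mem.2 ⟨hGA θ₀, ?_⟩⟩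
    exact fun x hx => congrArg Prod.snd (huniq θ₀ hθ₀ (θ₀, x) hx rfl)
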